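/- **Setting.** Let $n\ge 1$ and let $\mathbf Y=[\mathbf y_1\cdots\mathbf y_M]\in\mathbb R^{n\times M}$ be a matrix of training targets. Put $\bar{\mathbf y}=M^{-1}\sum_{i=1}^M\mathbf y_i$, $\bar{\mathbf Y}=[\bar{\mathbf y}\cdots\bar{\mathbf y}]$ and let $\mathbf\Sigma=M^{-1}(\mathbf Y-\bar{\mathbf Y})(\mathbf Y-\bar{\mathbf Y})^T$ be the sample covariance matrix, assumed to have full rank $n$, with eigenvalues $\lambda_1\ge\dots\ge\lambda_n$. Let $\mathbf V=\mathrm{diag}(\sigma_1^2,\dots,\sigma_n^2)$, where $\sigma_j^2=M^{-1}\sum_{i}(\mathbf Y_{ji}-\bar{\mathbf y}_j)^2$ is the variance of the $j$-th target component, let $\mathbf Y^{nrm}=\mathbf V^{-1/2}(\mathbf Y-\bar{\mathbf Y})$ be the normalized targets, and let $\mathbf P=\mathbf V^{-1/2}\mathbf\Sigma\mathbf V^{-1/2}$ be the sample correlation matrix, with smallest and largest eigenvalues $\tilde\lambda_{\min}$ and $\tilde\lambda_{\max}$. Let $\lambda_{\mathbf H},\lambda_{\mathbf W}\ge 0$ and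 $c=\lambda_{\mathbf H}\lambda_{\mathbf W}$. For a feature dimension $d$, $\mathbf H\in\mathbb R^{d\times M}$, $\mathbf W\in\mathbb R^{n\times d}$ and $\mathbf b\in\mathbb R^n$, consider the unconstrained feature model (UFM) loss on the normalized targets $$\mathcal L(\mathbf H,\mathbf W,\mathbf b)=\frac1{2M}\|\mathbf W\mathbf H+\mathbf b\mathbf 1_M^T-\mathbf Y^{nrm}\|_F^2+\frac{\lambda_{\mathbf H}}{2M}\|\mathbf H\|_F^2+\frac{\lambda_{\mathbf W}}2\|\mathbf W\|_F^2,$$ the bias-free loss $\mathcal L(\mathbf H,\mathbf W)=\mathcal L(\mathbf H,\mathbf W,\mathbf 0)$, and the training MSE after de-normalizing the predictions $\mathbf W\mathbf H$, $$\mathrm{MSE}(\text{de-normalize})=M^{-1}\big\|\mathbf V^{1/2}\mathbf W\mathbf H+\bar{\mathbf Y}-\mathbf Y\big\|_F^2 .$$ **Theorem.** 0. If $c>0$, then $(\mathbf H,\mathbf W,\mathbf b)$ is a global minimum of $\mathcal L(\mathbf H,\mathbf W,\mathbf b)$ if and only if $\mathbf b=\mathbf 0$ and $(\mathbf H,\mathbf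 W)$ is a global minimum of the bias-free loss. 1. Suppose $d\ge n$ and $0<c<\tilde\lambda_{\min}$. Then $(\mathbf H,\mathbf W)$ is a global minimum of the bias-free loss if and only if there is a semi-orthogonal $\mathbf R\in\mathbb R^{n\times d}$ (that is, $\mathbf R\mathbf R^T=\mathbf I_n$) with $$\mathbf W=\Big(\frac{\lambda_{\mathbf H}}{\lambda_{\mathbf W}}\Big)^{1/4}\big(\mathbf P^{1/2}-\sqrt c\,\mathbf I_n\big)^{1/2}\mathbf R,\qquad \mathbf H=\sqrt{\frac{\lambda_{\mathbf W}}{\lambda_{\mathbf H}}}\;\mathbf W^T\mathbf P^{-1/2}\mathbf Y^{nrm}.$$ Every global minimum satisfies $\mathbf W\mathbf H=(\mathbf I_n-\sqrt c\,\mathbf P^{-1/2})\mathbf Y^{nrm}$ and $\mathrm{MSE}(\text{de-normalize})=c\sum_{i=1}^n\lambda_i$. 2. Suppose $c>\tilde\lambda_{\max}$ (and $d$ is arbitrary). Then $(\mathbf H,\mathbf W)=(\mathbf 0,\mathbf 0)$ is the unique global minimum of the bias-free loss, and for it $\mathrm{MSE}(\text{de-normalize})=\sum_{i=1}^n\lambda_i$.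 -/

import Mathlib

/-! Multivariate regression targets are stored as an `n × M` real matrix `Y` whose columns are the
`M` training targets. -/

namespace UFM

open scoped Matrix MatrixOrder

/-- The squared Frobenius norm `‖A‖_F²`. -/
def frobSq {m k : ℕ} (A : Matrix (Fin m) (Fin k) ℝ) : ℝ :=
  ∑ i, ∑ j, A i j ^ 2

/-- The mean matrix `Ȳ = [ȳ ⋯ ȳ]`, where `ȳ = M⁻¹ ∑ᵢ yᵢ`. -/
noncomputable def meanMatrix {n M : ℕ} (Y : Matrix (Fin n) (Fin M) ℝ) :
    Matrix (Fin n) (Fin M) ℝ :=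
  Matrix.of fun j _ => (M : ℝ)⁻¹ * ∑ i, Y j i

/-- The sample covariance matrix `Σ = M⁻¹ (Y - Ȳ)(Y - Ȳ)ᵀ`. -/
noncomputable def sampleCov {n M : ℕ} (Y : Matrix (Fin n) (Fin M) ℝ) :
    Matrix (Fin n) (Fin n) ℝ :=
  (M : ℝ)⁻¹ • ((Y - meanMatrix Y) * (Y - meanMatrix Y)ᵀ)

/-- The (biased) sample variance `σ_j² = M⁻¹ ∑ᵢ (Y_{ji} - ȳ_j)²` of the `j`-th target component. -/
noncomputable def targetVar {n M : ℕ} (Y : Matrix (Fin n) (Fin M) ℝ) (j : Fin n) : ℝ :=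
  (M : ℝ)⁻¹ * ∑ i, (Y j i - meanMatrix Y j i) ^ 2

/-- `V^{1/2}` for `V = diag(σ_1², …, σ_n²)`. -/
noncomputable def stdMatrix {n M : ℕ} (Y : Matrix (Fin n) (Fin M) ℝ) :
    Matrix (Fin n) (Fin n) ℝ :=
  Matrix.diagonal fun j => √(targetVar Y j)

/-- `V^{-1/2}` for `V = diag(σ_1², …, σ_n²)`. -/
noncomputable def invStdMatrix {n M : ℕ} (Y : Matrix (Fin n) (Fin M) ℝ) :
    Matrix (Fin n) (Fin n) ℝ :=
  Matrix.diagonal fun j => (√(targetVar Y j))⁻¹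

/-- The normalized targets `Y^nrm = V^{-1/2} (Y - Ȳ)`. -/
noncomputable def normalizedTargets {n M : ℕ} (Y : Matrix (Fin n) (Fin M) ℝ) :
    Matrix (Fin n) (Fin M) ℝ :=
  invStdMatrix Y * (Y - meanMatrix Y)

/-- The sample correlation matrix `P = V^{-1/2} Σ V^{-1/2}`. -/
noncomputable def sampleCorr {n M : ℕ} (Y : Matrix (Fin n) (Fin M) ℝ) :
    Matrix (Fin n) (Fin n) ℝ :=
  invStdMatrix Y * sampleCov Y * invStdMatrix Y

theorem sampleCov_isHermitian {n M : ℕ} (Y : Matrix (Fin n) (Fin M) ℝ) :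
    (sampleCov Y).IsHermitian := by
  ext i j
  simp [sampleCov, Matrix.mul_apply, mul_comm]

theorem sampleCorr_isHermitian {n M : ℕ} (Y : Matrix (Fin n) (Fin M) ℝ) :
    (sampleCorr Y).IsHermitian := by
  have h := (sampleCov_isHermitian Y).eq
  simp only [Matrix.conjTranspose_eq_transpose_of_trivial] at h
  simp only [Matrix.IsHermitian, Matrix.conjTranspose_eq_transpose_of_trivial, sampleCorr,
    Matrix.transpose_mul, invStdMatrix, Matrix.diagonal_transpose, h, Matrix.mul_assoc]

/-- `∑ᵢ λᵢ`, the sum (with multiplicity) of the eigenvalues of the sample covariance matrix. -/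
noncomputable def covEigenvalueSum {n M : ℕ} (Y : Matrix (Fin n) (Fin M) ℝ) : ℝ :=
  ∑ i, (sampleCov_isHermitian Y).eigenvalues i

/-- The smallest eigenvalue of the sample correlation matrix (meaningful for `n ≥ 1`). -/
noncomputable def corrEigenvalueMin {n M : ℕ} (Y : Matrix (Fin n) (Fin M) ℝ) : ℝ :=
  ⨅ i, (sampleCorr_isHermitian Y).eigenvalues i

/-- The largest eigenvalue of the sample correlation matrix (meaningful for `n ≥ 1`). -/
noncomputable def corrEigenvalueMax {n M : ℕ} (Y : Matrix (Fin n) (Fin M) ℝ) : ℝ :=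
  ⨆ i, (sampleCorr_isHermitian Y).eigenvalues i

/-- `P^{1/2}`, the positive semidefinite square root of the sample correlation matrix. -/
noncomputable def corrSqrt {n M : ℕ} (Y : Matrix (Fin n) (Fin M) ℝ) :
    Matrix (Fin n) (Fin n) ℝ :=
  CFC.sqrt (sampleCorr Y)

/-- The UFM-loss with bias for targets `T`:
`(2M)⁻¹ ‖W H + b 1ᵀ - T‖_F² + λ_H (2M)⁻¹ ‖H‖_F² + (λ_W / 2) ‖W‖_F²`. -/
noncomputable def lossWithBias {n M d : ℕ} (lamH lamW : ℝ) (T : Matrix (Fin n) (Fin M) ℝ)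
    (H : Matrix (Fin d) (Fin M) ℝ) (W : Matrix (Fin n) (Fin d) ℝ) (b : Fin n → ℝ) : ℝ :=
  1 / (2 * (M : ℝ)) * frobSq (W * H + Matrix.vecMulVec b (fun _ => 1) - T)
    + lamH / (2 * (M : ℝ)) * frobSq H + lamW / 2 * frobSq W

/-- The UFM-loss without bias for targets `T`:
`(2M)⁻¹ ‖W H - T‖_F² + λ_H (2M)⁻¹ ‖H‖_F² + (λ_W / 2) ‖W‖_F²`. -/
noncomputable def loss {n M d : ℕ} (lamH lamW : ℝ) (T : Matrix (Fin n) (Fin M) ℝ)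
    (H : Matrix (Fin d) (Fin M) ℝ) (W : Matrix (Fin n) (Fin d) ℝ) : ℝ :=
  1 / (2 * (M : ℝ)) * frobSq (W * H - T)
    + lamH / (2 * (M : ℝ)) * frobSq H + lamW / 2 * frobSq W

/-- `(H, W, b)` is a global minimum of the UFM-loss with bias. -/
def IsGlobalMinWithBias {n M d : ℕ} (lamH lamW : ℝ) (T : Matrix (Fin n) (Fin M) ℝ)
    (H : Matrix (Fin d) (Fin M) ℝ) (W : Matrix (Fin n) (Fin d) ℝ) (b : Fin n → ℝ) : Prop :=
  ∀ (H' : Matrix (Fin d) (Fin M) ℝ) (W' : Matrix (Fin n) (Fin d) ℝ) (b' : Fin n → ℝ),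
    lossWithBias lamH lamW T H W b ≤ lossWithBias lamH lamW T H' W' b'

/-- `(H, W)` is a global minimum of the UFM-loss without bias. -/
def IsGlobalMin {n M d : ℕ} (lamH lamW : ℝ) (T : Matrix (Fin n) (Fin M) ℝ)
    (H : Matrix (Fin d) (Fin M) ℝ) (W : Matrix (Fin n) (Fin d) ℝ) : Prop :=
  ∀ (H' : Matrix (Fin d) (Fin M) ℝ) (W' : Matrix (Fin n) (Fin d) ℝ),
    loss lamH lamW T H W ≤ loss lamH lamW T H' W'

/-- The predictions `V^{1/2} Z + Ȳ` obtained by de-normalizing predictions `Z` of `Y^nrm`. -/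
noncomputable def denormalize {n M : ℕ} (Y Z : Matrix (Fin n) (Fin M) ℝ) :
    Matrix (Fin n) (Fin M) ℝ :=
  stdMatrix Y * Z + meanMatrix Y

/-- `MSE(de-normalize) = M⁻¹ ‖(V^{1/2} W H + Ȳ) - Y‖_F²`. -/
noncomputable def mseDenormalize {n M d : ℕ} (Y : Matrix (Fin n) (Fin M) ℝ)
    (H : Matrix (Fin d) (Fin M) ℝ) (W : Matrix (Fin n) (Fin d) ℝ) : ℝ :=
  (M : ℝ)⁻¹ * frobSq (denormalize Y (W * H) - Y)

end UFM

/-! Write `T` for the normalized targets, `Q = P^{1/2}` and `K = W Wᵀ + λ_H I`, so `T Tᵀ = M Q²`.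
For fixed `W` the loss is a ridge regression in `H`. Eliminating `H` leaves, up to the factor `M`
and a constant, `λ_H tr(Q K⁻¹ Q) + λ_W tr K`. With `D = √λ_H Q - √λ_W K` this equals `2√c tr Q +
tr(D K⁻¹ D)`, a matrix AM-GM identity; `loss_decomposition` records the result.

Under weak regularization `Q - √c I` is positive definite. When `n ≤ d`, the equation `D = 0` is
then solvable in `W`, and its solutions are a matrix square root times a semi-orthogonal factor. The
residual at a minimum is `-√c Q⁻¹ T`. Since `Q⁻¹ T` has Gram matrix `M I`, de-normalizing gives MSE
`c tr V = c tr Σ`.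

Under strong regularization no factorization is needed: discard `‖W H‖²`, complete the square in
`H`, and bound `‖Wᵀ T‖²` by the top eigenvalue of `P`. What remains is a positive multiple of
`‖W‖²`.

The bias is useless because `T` has zero row sums: the loss splits orthogonally into a centered part
and a mean part, and the mean part is a sum of squares. -/

namespace UFM

open scoped Matrix MatrixOrder

/-! ### Frobenius norm identities. -/

section Frobenius

variable {m k : ℕ}

theorem frobSq_eq_trace (A : Matrix (Fin m) (Fin k) ℝ) : frobSq A = (A * Aᵀ).trace := by
  simp [frobSq, Matrix.trace, Matrix.mul_apply, pow_two]

theorem frobSq_nonneg (A : Matrix (Fin m) (Fin k) ℝ) : 0 ≤ frobSq A :=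
  Finset.sum_nonneg fun _ _ => Finset.sum_nonneg fun _ _ => sq_nonneg _

theorem frobSq_eq_zero_iff {A : Matrix (Fin m) (Fin k) ℝ} : frobSq A = 0 ↔ A = 0 := by
  constructor
  · intro h
    have h1 := (Finset.sum_eq_zero_iff_of_nonneg
      fun i _ => Finset.sum_nonneg fun j _ => sq_nonneg (A i j)).1 h
    ext i j
    have h2 := (Finset.sum_eq_zero_iff_of_nonneg fun j _ => sq_nonneg (A i j)).1
      (h1 i (Finset.mem_univ i)) j (Finset.mem_univ j)
    simpa using h2
  · rintro rfl
    simp [frobSq]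

theorem frobSq_neg (A : Matrix (Fin m) (Fin k) ℝ) : frobSq (-A) = frobSq A := by
  simp [frobSq]

theorem frobSq_smul (r : ℝ) (A : Matrix (Fin m) (Fin k) ℝ) :
    frobSq (r • A) = r ^ 2 * frobSq A := by
  simp [frobSq, mul_pow, Finset.mul_sum]

theorem frobSq_add (A B : Matrix (Fin m) (Fin k) ℝ) :
    frobSq (A + B) = frobSq A + 2 * (A * Bᵀ).trace + frobSq B := by
  have h : (B * Aᵀ).trace = (A * Bᵀ).trace := by
    rw [← Matrix.trace_transpose, Matrix.transpose_mul, Matrix.transpose_transpose]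
  simp only [frobSq_eq_trace, Matrix.transpose_add, Matrix.mul_add, Matrix.add_mul,
    Matrix.trace_add, h]
  ring

theorem frobSq_sub (A B : Matrix (Fin m) (Fin k) ℝ) :
    frobSq (A - B) = frobSq A - 2 * (A * Bᵀ).trace + frobSq B := by
  rw [sub_eq_add_neg, frobSq_add, frobSq_neg]
  simp
  ring

end Frobenius

/-- If the row sums of `A` vanish, adding `v` to each of its `M` columns adds `M ‖v‖²` to the squared
Frobenius norm. -/
theorem frobSq_add_const {m M : ℕ} (A : Matrix (Fin m) (Fin M) ℝ) (hA : ∀ i, ∑ j, A i j = 0)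
    (v : Fin m → ℝ) :
    frobSq (A + Matrix.vecMulVec v (fun _ => 1)) = frobSq A + M * ∑ i, v i ^ 2 := by
  have h : ∀ i, ∑ j, (A i j + v i) ^ 2 = ∑ j, A i j ^ 2 + M * v i ^ 2 := by
    intro i
    simp only [add_sq, Finset.sum_add_distrib, ← Finset.sum_mul, ← Finset.mul_sum, hA i]
    simp
  simp [frobSq, Matrix.vecMulVec_apply, h, Finset.sum_add_distrib, Finset.mul_sum]

theorem sum_sub_meanMatrix {n M : ℕ} (hM : 0 < M) (Y : Matrix (Fin n) (Fin M) ℝ) (i : Fin n) :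
    ∑ j, (Y - meanMatrix Y) i j = 0 := by
  have : (M : ℝ) ≠ 0 := by positivity
  simp [meanMatrix, this]

theorem sum_mul_eq_zero {n m M : ℕ} (A : Matrix (Fin n) (Fin m) ℝ) (B : Matrix (Fin m) (Fin M) ℝ)
    (hB : ∀ i, ∑ j, B i j = 0) (i : Fin n) : ∑ j, (A * B) i j = 0 := by
  simp only [Matrix.mul_apply]
  rw [Finset.sum_comm]
  simp [← Finset.mul_sum, hB]

/-! ### Removing the bias by centering the features. -/

section Centering

variable {n M d : ℕ} {lamH lamW : ℝ} {T : Matrix (Fin n) (Fin M) ℝ}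

theorem lossWithBias_zero (H : Matrix (Fin d) (Fin M) ℝ) (W : Matrix (Fin n) (Fin d) ℝ) :
    lossWithBias lamH lamW T H W 0 = loss lamH lamW T H W := by
  simp [lossWithBias, loss]

/-- Centered columns are orthogonal to constant ones, so the mean of the features enters the loss
only through its own penalty and through an effective bias `W h + b`. -/
theorem lossWithBias_eq_centered (hM : 0 < M) (hT : ∀ i, ∑ j, T i j = 0)
    (H : Matrix (Fin d) (Fin M) ℝ) (W : Matrix (Fin n) (Fin d) ℝ) (b : Fin n → ℝ) :
    ∃ h : Fin d → ℝ, lossWithBias lamH lamW T H W b = loss lamH lamW T (H - meanMatrix H) W +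
      (1 / 2 * ∑ i, (W *ᵥ h + b) i ^ 2 + lamH / 2 * ∑ i, h i ^ 2) := by
  set G := H - meanMatrix H with hG
  have hG0 := sum_sub_meanMatrix hM H
  rw [← hG] at hG0
  refine ⟨fun i => (M : ℝ)⁻¹ * ∑ j, H i j, ?_⟩
  set h : Fin d → ℝ := fun i => (M : ℝ)⁻¹ * ∑ j, H i j
  have hH : H = G + Matrix.vecMulVec h (fun _ => 1) := by
    ext i j
    simp [hG, h, meanMatrix, Matrix.vecMulVec_apply]
  have e1 : W * H + Matrix.vecMulVec b (fun _ => 1) - T =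
      (W * G - T) + Matrix.vecMulVec (W *ᵥ h + b) (fun _ => 1) := by
    rw [hH, Matrix.mul_add, Matrix.mul_vecMulVec, Matrix.add_vecMulVec]
    abel
  have h0 : ∀ i, ∑ j, (W * G - T) i j = 0 := fun i => by
    simp only [Matrix.sub_apply, Finset.sum_sub_distrib, sum_mul_eq_zero W G hG0, hT, sub_zero]
  have e2 : frobSq H = frobSq G + M * ∑ i, h i ^ 2 := by
    conv_lhs => rw [hH]
    exact frobSq_add_const G hG0 h
  have hM' : (M : ℝ) ≠ 0 := by positivity
  rw [lossWithBias, e1, frobSq_add_const _ h0, e2, loss]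
  field_simp
  ring

theorem isGlobalMinWithBias_iff (hM : 0 < M) (hT : ∀ i, ∑ j, T i j = 0) (hH : 0 < lamH)
    (H : Matrix (Fin d) (Fin M) ℝ) (W : Matrix (Fin n) (Fin d) ℝ) (b : Fin n → ℝ) :
    IsGlobalMinWithBias lamH lamW T H W b ↔ IsGlobalMin lamH lamW T H W ∧ b = 0 := by
  constructor
  · intro hmin
    have hb : b = 0 := by
      obtain ⟨h, h2⟩ := lossWithBias_eq_centered (lamH := lamH) (lamW := lamW) hM hT H W b
      -- The competitor with centered features and no bias has the same centered loss, so both extra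
      -- squares must vanish. Then `h = 0`, and `W h + b = 0` gives `b = 0`.
      have h3 := hmin (H - meanMatrix H) W 0
      rw [lossWithBias_zero, h2] at h3
      have p1 : 0 ≤ ∑ i, (W *ᵥ h + b) i ^ 2 := Finset.sum_nonneg fun _ _ => sq_nonneg _
      have p2 : 0 ≤ ∑ i, h i ^ 2 := Finset.sum_nonneg fun _ _ => sq_nonneg _
      have z2 : ∑ i, h i ^ 2 = 0 := by
        have : lamH * ∑ i, h i ^ 2 ≤ 0 := by linarith
        nlinarith
      have z1 : ∑ i, (W *ᵥ h + b) i ^ 2 = 0 := by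
        rw [z2] at h3
        linarith
      have h0 : h = 0 := by
        ext i
        simpa using (Finset.sum_eq_zero_iff_of_nonneg fun i _ => sq_nonneg (h i)).1 z2 i
          (Finset.mem_univ i)
      subst h0
      ext i
      simpa using (Finset.sum_eq_zero_iff_of_nonneg fun i _ => sq_nonneg _).1 z1 i
        (Finset.mem_univ i)
    subst hb
    refine ⟨fun H' W' => ?_, rfl⟩
    simpa only [lossWithBias_zero] using hmin H' W' 0
  · rintro ⟨hmin, rfl⟩ H' W' b'
    obtain ⟨h, h2⟩ := lossWithBias_eq_centered (lamH := lamH) (lamW := lamW) hM hT H' W' b'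
    rw [lossWithBias_zero, h2]
    refine (hmin (H' - meanMatrix H') W').trans (le_add_of_nonneg_right ?_)
    have p1 : 0 ≤ ∑ i, (W' *ᵥ h + b') i ^ 2 := Finset.sum_nonneg fun _ _ => sq_nonneg _
    have p2 : 0 ≤ ∑ i, h i ^ 2 := Finset.sum_nonneg fun _ _ => sq_nonneg _
    positivity

end Centering

/-! ### Eliminating `H` and the matrix AM-GM identity. -/

section Loss

variable {n M d : ℕ} {lamH lamW : ℝ} {T : Matrix (Fin n) (Fin M) ℝ}

/-- Completing the square in `H`, where `T = (W Wᵀ + λ_H) X`. -/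
theorem frobSq_ridge (W : Matrix (Fin n) (Fin d) ℝ) (X : Matrix (Fin n) (Fin M) ℝ)
    (E : Matrix (Fin d) (Fin M) ℝ) (hT : T = W * Wᵀ * X + lamH • X) :
    frobSq (W * (Wᵀ * X + E) - T) + lamH * frobSq (Wᵀ * X + E) =
      frobSq (W * E) + lamH * frobSq E + lamH * (X * Tᵀ).trace := by
  have e : W * (Wᵀ * X + E) - T = W * E - lamH • X := by
    rw [hT, Matrix.mul_add, Matrix.mul_assoc]; abel
  have h1 : (Wᵀ * X * Eᵀ).trace = (W * E * Xᵀ).trace := by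
    rw [← Matrix.trace_transpose]
    simp only [Matrix.transpose_mul, Matrix.transpose_transpose]
    rw [← Matrix.mul_assoc, Matrix.trace_mul_comm, ← Matrix.mul_assoc]
  have h2 : (X * Tᵀ).trace = frobSq (Wᵀ * X) + lamH * frobSq X := by
    rw [hT, frobSq_eq_trace, frobSq_eq_trace]
    simp only [Matrix.transpose_add, Matrix.transpose_mul, Matrix.transpose_transpose,
      Matrix.mul_add, Matrix.trace_add, Matrix.transpose_smul, Matrix.mul_smul,
      Matrix.trace_smul, smul_eq_mul]
    congr 1
    rw [Matrix.mul_assoc, Matrix.trace_mul_comm Wᵀ]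
    simp only [Matrix.mul_assoc]
  rw [e, frobSq_sub, frobSq_add, frobSq_smul, h1, h2]
  simp only [Matrix.transpose_smul, Matrix.mul_smul, Matrix.trace_smul, smul_eq_mul]
  ring

/-- The regularized Gram matrix `W Wᵀ + λ_H I`. -/
def regGram (lamH : ℝ) (W : Matrix (Fin n) (Fin d) ℝ) : Matrix (Fin n) (Fin n) ℝ :=
  W * Wᵀ + lamH • (1 : Matrix (Fin n) (Fin n) ℝ)

theorem regGram_posDef (hH : 0 < lamH) (W : Matrix (Fin n) (Fin d) ℝ) :
    (regGram lamH W).PosDef := by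
  have h1 : (W * Wᵀ).PosSemidef := by
    simpa using Matrix.posSemidef_self_mul_conjTranspose W
  exact Matrix.PosDef.posSemidef_add h1 (Matrix.PosDef.one.smul hH)

theorem trace_regGram (W : Matrix (Fin n) (Fin d) ℝ) :
    (regGram lamH W).trace = frobSq W + n * lamH := by
  simp [regGram, frobSq_eq_trace, mul_comm]

/-- The loss as its minimal value plus squares that vanish at the ridge solution `H` for `W` and at
balanced `W`. Here `Q` is a square root of `M⁻¹ T Tᵀ`. -/
theorem loss_decomposition (hM : 0 < M) (hH : 0 < lamH) (hW : 0 < lamW)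
    {Q : Matrix (Fin n) (Fin n) ℝ} (hTQ : T * Tᵀ = (M : ℝ) • (Q * Q))
    (H : Matrix (Fin d) (Fin M) ℝ) (W : Matrix (Fin n) (Fin d) ℝ) :
    2 * M * loss lamH lamW T H W =
      frobSq (W * (H - Wᵀ * ((regGram lamH W)⁻¹ * T))) +
      lamH * frobSq (H - Wᵀ * ((regGram lamH W)⁻¹ * T)) +
      M * ((√lamH • Q - √lamW • regGram lamH W) * (regGram lamH W)⁻¹ *
        (√lamH • Q - √lamW • regGram lamH W)).trace +
      M * (2 * √(lamH * lamW) * Q.trace - n * (lamH * lamW)) := by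
  have hM' : (M : ℝ) ≠ 0 := by positivity
  set K := regGram lamH W with hK
  have hdet : IsUnit K.det := (Matrix.isUnit_iff_isUnit_det _).1 (regGram_posDef hH W).isUnit
  set X := K⁻¹ * T with hX
  set E := H - Wᵀ * X with hE
  have hHE : H = Wᵀ * X + E := by rw [hE]; abel
  have hT : T = W * Wᵀ * X + lamH • X := by
    have : K * X = T := Matrix.mul_nonsing_inv_cancel_left K T hdet
    rw [← this, hK, regGram, Matrix.add_mul, Matrix.smul_mul, Matrix.one_mul]
  have h1 := frobSq_ridge W X E hT
  rw [← hHE] at h1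
  have h2 : (X * Tᵀ).trace = M * (Q * K⁻¹ * Q).trace := by
    rw [hX, Matrix.mul_assoc, hTQ, Matrix.mul_smul, Matrix.trace_smul, smul_eq_mul,
      Matrix.trace_mul_comm, Matrix.mul_assoc, Matrix.trace_mul_comm]
  have s1 := Real.mul_self_sqrt hH.le
  have s2 := Real.mul_self_sqrt hW.le
  -- Expansion of the AM-GM square: `K⁻¹` cancels against `K` in the cross terms, leaving a multiple
  -- of `tr Q` that does not involve `W`.
  have h3 : ((√lamH • Q - √lamW • K) * K⁻¹ * (√lamH • Q - √lamW • K)).trace =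
      lamH * (Q * K⁻¹ * Q).trace - 2 * √(lamH * lamW) * Q.trace + lamW * K.trace := by
    have a1 : Q * K⁻¹ * K = Q := Matrix.nonsing_inv_mul_cancel_right K Q hdet
    have a2 : K * K⁻¹ = 1 := Matrix.mul_nonsing_inv K hdet
    simp only [Matrix.sub_mul, Matrix.mul_sub, Matrix.smul_mul, Matrix.mul_smul, a1, a2,
      Matrix.one_mul, Matrix.trace_sub, Matrix.trace_smul, smul_eq_mul]
    rw [Real.sqrt_mul hH.le]
    linear_combination (Q * K⁻¹ * Q).trace * s1 + K.trace * s2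
  rw [h3, hK, trace_regGram, ← hK]
  rw [h2] at h1
  have h4 : 2 * M * loss lamH lamW T H W =
      frobSq (W * H - T) + lamH * frobSq H + M * lamW * frobSq W := by
    rw [loss]
    field_simp
  rw [h4, h1]
  ring

end Loss

/-! ### Spectral bounds and square roots. -/

section Spectral

variable {m : ℕ} {A : Matrix (Fin m) (Fin m) ℝ}

theorem posSemidef_sub_smul_one (hA : A.IsHermitian) {r : ℝ} (h : ∀ i, r ≤ hA.eigenvalues i) :
    (A - r • (1 : Matrix (Fin m) (Fin m) ℝ)).PosSemidef := by
  rw [← Matrix.le_iff, ← Algebra.algebraMap_eq_smul_one,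
    algebraMap_le_iff_le_spectrum (p := IsSelfAdjoint) (ha := hA),
    hA.spectrum_real_eq_range_eigenvalues]
  rintro _ ⟨i, rfl⟩
  exact h i

theorem posSemidef_smul_one_sub (hA : A.IsHermitian) {r : ℝ} (h : ∀ i, hA.eigenvalues i ≤ r) :
    (r • (1 : Matrix (Fin m) (Fin m) ℝ) - A).PosSemidef := by
  rw [← Matrix.le_iff, ← Algebra.algebraMap_eq_smul_one,
    le_algebraMap_iff_spectrum_le (p := IsSelfAdjoint) (ha := hA),
    hA.spectrum_real_eq_range_eigenvalues]
  rintro _ ⟨i, rfl⟩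
  exact h i

theorem posSemidef_sqrt (A : Matrix (Fin m) (Fin m) ℝ) : (CFC.sqrt A).PosSemidef :=
  Matrix.nonneg_iff_posSemidef.1 (CFC.sqrt_nonneg A)

theorem sqrt_transpose (A : Matrix (Fin m) (Fin m) ℝ) : (CFC.sqrt A)ᵀ = CFC.sqrt A := by
  simpa using (posSemidef_sqrt A).isHermitian.eq

theorem sqrt_mul_sqrt (hA : A.PosSemidef) : CFC.sqrt A * CFC.sqrt A = A :=
  CFC.sqrt_mul_sqrt_self A hA.nonneg

/-- Squares of eigenvalues of `A^{1/2}` are eigenvalues of `A`, so the spectrum of `A^{1/2}` lies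
strictly above `√c`. -/
theorem posDef_sqrt_sub_smul_one (hA : A.IsHermitian) {c : ℝ} (hc : 0 ≤ c)
    (h : ∀ i, c < hA.eigenvalues i) :
    (CFC.sqrt A - √c • (1 : Matrix (Fin m) (Fin m) ℝ)).PosDef := by
  have hps : A.PosSemidef :=
    hA.posSemidef_iff_eigenvalues_nonneg.2 fun i => hc.trans (h i).le
  have hS := posSemidef_sqrt A
  have hlt : ∀ x ∈ spectrum ℝ (CFC.sqrt A), √c < x := by
    intro x hx
    have hx0 : 0 ≤ x := by
      rw [hS.isHermitian.spectrum_real_eq_range_eigenvalues] at hx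
      obtain ⟨i, rfl⟩ := hx
      exact hS.eigenvalues_nonneg i
    have h2 := spectrum.pow_mem_pow (CFC.sqrt A) 2 hx
    rw [pow_two (CFC.sqrt A), sqrt_mul_sqrt hps, hA.spectrum_real_eq_range_eigenvalues] at h2
    obtain ⟨i, hi⟩ := h2
    have := h i
    rw [hi] at this
    exact (Real.sqrt_lt hc hx0).2 this
  have hle : (CFC.sqrt A - √c • (1 : Matrix (Fin m) (Fin m) ℝ)).PosSemidef :=
    posSemidef_sub_smul_one hS.isHermitian fun i => (hlt _ (by
      rw [hS.isHermitian.spectrum_real_eq_range_eigenvalues]; exact ⟨i, rfl⟩)).le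
  -- Strictness enters here: a singular difference would put `√c` itself in the spectrum.
  rw [hle.posDef_iff_isUnit, ← Algebra.algebraMap_eq_smul_one, ← neg_sub, IsUnit.neg_iff]
  by_contra hnu
  exact (hlt _ (spectrum.mem_iff.2 hnu)).false

end Spectral

/-! ### Covariance, correlation and de-normalization of the targets. -/

section Targets

variable {n M : ℕ} {Y : Matrix (Fin n) (Fin M) ℝ}

theorem targetVar_eq_sampleCov_apply (Y : Matrix (Fin n) (Fin M) ℝ) (j : Fin n) :
    targetVar Y j = sampleCov Y j j := by
  simp [targetVar, sampleCov, Matrix.mul_apply, pow_two]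

theorem sampleCov_posDef (hcov : (sampleCov Y).rank = n) : (sampleCov Y).PosDef := by
  have hps : (sampleCov Y).PosSemidef := by
    have := Matrix.posSemidef_self_mul_conjTranspose (Y - meanMatrix Y)
    rw [Matrix.conjTranspose_eq_transpose_of_trivial] at this
    exact this.smul (by positivity : (0 : ℝ) ≤ (M : ℝ)⁻¹)
  rw [hps.posDef_iff_isUnit, ← Matrix.mulVec_surjective_iff_isUnit]
  have : LinearMap.range (sampleCov Y).mulVecLin = ⊤ := by
    apply Submodule.eq_top_of_finrank_eq
    rw [← Matrix.rank, hcov, Module.finrank_fin_fun]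
  exact LinearMap.range_eq_top.1 this

theorem targetVar_pos (hcov : (sampleCov Y).PosDef) (j : Fin n) : 0 < targetVar Y j := by
  rw [targetVar_eq_sampleCov_apply]
  exact hcov.diag_pos

theorem stdMatrix_mul_invStdMatrix (hcov : (sampleCov Y).PosDef) :
    stdMatrix Y * invStdMatrix Y = 1 := by
  rw [stdMatrix, invStdMatrix, Matrix.diagonal_mul_diagonal, ← Matrix.diagonal_one]
  congr 1
  ext j
  exact mul_inv_cancel₀ (Real.sqrt_pos.2 (targetVar_pos hcov j)).ne'

theorem invStdMatrix_transpose (Y : Matrix (Fin n) (Fin M) ℝ) :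
    (invStdMatrix Y)ᵀ = invStdMatrix Y := by
  simp [invStdMatrix]

theorem stdMatrix_transpose (Y : Matrix (Fin n) (Fin M) ℝ) :
    (stdMatrix Y)ᵀ = stdMatrix Y := by
  simp [stdMatrix]

theorem stdMatrix_mul_normalizedTargets (hcov : (sampleCov Y).PosDef) :
    stdMatrix Y * normalizedTargets Y = Y - meanMatrix Y := by
  rw [normalizedTargets, ← Matrix.mul_assoc, stdMatrix_mul_invStdMatrix hcov, Matrix.one_mul]

theorem normalizedTargets_mul_transpose (hM : 0 < M) (Y : Matrix (Fin n) (Fin M) ℝ) :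
    normalizedTargets Y * (normalizedTargets Y)ᵀ = (M : ℝ) • sampleCorr Y := by
  have : (M : ℝ) ≠ 0 := by positivity
  simp only [normalizedTargets, sampleCorr, sampleCov, Matrix.transpose_mul,
    invStdMatrix_transpose, Matrix.mul_smul, Matrix.smul_mul, smul_smul, mul_inv_cancel₀ this,
    one_smul, Matrix.mul_assoc]

theorem sum_normalizedTargets (hM : 0 < M) (Y : Matrix (Fin n) (Fin M) ℝ) (i : Fin n) :
    ∑ j, normalizedTargets Y i j = 0 :=
  sum_mul_eq_zero _ _ (sum_sub_meanMatrix hM Y) i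

theorem sampleCorr_posDef (hcov : (sampleCov Y).PosDef) : (sampleCorr Y).PosDef := by
  have hu : IsUnit (invStdMatrix Y) :=
    IsUnit.of_mul_eq_one_right _ (stdMatrix_mul_invStdMatrix hcov)
  have h := (Matrix.IsUnit.posDef_star_right_conjugate_iff hu).2 hcov
  rwa [Matrix.star_eq_conjTranspose, Matrix.conjTranspose_eq_transpose_of_trivial,
    invStdMatrix_transpose] at h

theorem covEigenvalueSum_eq_trace (Y : Matrix (Fin n) (Fin M) ℝ) :
    covEigenvalueSum Y = (sampleCov Y).trace := by
  rw [(sampleCov_isHermitian Y).trace_eq_sum_eigenvalues]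
  rfl

/-- The diagonal of `Σ` consists of the target variances, so `tr V = tr Σ`. -/
theorem frobSq_stdMatrix (hcov : (sampleCov Y).PosDef) :
    frobSq (stdMatrix Y) = covEigenvalueSum Y := by
  rw [frobSq_eq_trace, stdMatrix_transpose, covEigenvalueSum_eq_trace, stdMatrix,
    Matrix.diagonal_mul_diagonal, Matrix.trace_diagonal, Matrix.trace]
  refine Finset.sum_congr rfl fun j _ => ?_
  rw [Real.mul_self_sqrt (targetVar_pos hcov j).le, targetVar_eq_sampleCov_apply, Matrix.diag_apply]

theorem corrEigenvalueMin_le (Y : Matrix (Fin n) (Fin M) ℝ) (i : Fin n) :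
    corrEigenvalueMin Y ≤ (sampleCorr_isHermitian Y).eigenvalues i :=
  ciInf_le (Set.finite_range _).bddBelow i

theorem le_corrEigenvalueMax (Y : Matrix (Fin n) (Fin M) ℝ) (i : Fin n) :
    (sampleCorr_isHermitian Y).eigenvalues i ≤ corrEigenvalueMax Y :=
  le_ciSup (f := (sampleCorr_isHermitian Y).eigenvalues) (Set.finite_range _).bddAbove i

theorem mseDenormalize_eq {d : ℕ} (hcov : (sampleCov Y).PosDef) (H : Matrix (Fin d) (Fin M) ℝ)
    (W : Matrix (Fin n) (Fin d) ℝ) :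
    mseDenormalize Y H W =
      (M : ℝ)⁻¹ * frobSq (stdMatrix Y * (W * H - normalizedTargets Y)) := by
  rw [mseDenormalize, denormalize, Matrix.mul_sub, stdMatrix_mul_normalizedTargets hcov]
  congr 2
  abel

/-- `Q⁻¹ T` is whitened: its Gram matrix is `M I`, so only `‖V^{1/2}‖_F² = tr V` survives. It is
applied to the residual with `r = -√c`. -/
theorem frobSq_stdMatrix_mul (hM : 0 < M) (Y : Matrix (Fin n) (Fin M) ℝ) (hcov : (sampleCov Y).PosDef)
    (hQ : IsUnit (corrSqrt Y)) (r : ℝ) :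
    (M : ℝ)⁻¹ * frobSq (stdMatrix Y * (r • (corrSqrt Y)⁻¹ * normalizedTargets Y)) =
      r ^ 2 * covEigenvalueSum Y := by
  have hM' : (M : ℝ) ≠ 0 := by positivity
  have hdet : IsUnit (corrSqrt Y).det := (Matrix.isUnit_iff_isUnit_det _).1 hQ
  have hT : (corrSqrt Y)⁻¹ᵀ = (corrSqrt Y)⁻¹ := by
    rw [Matrix.transpose_nonsing_inv, corrSqrt, sqrt_transpose]
  have hP : corrSqrt Y * corrSqrt Y = sampleCorr Y := sqrt_mul_sqrt (sampleCorr_posDef hcov).posSemidef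
  have key : (corrSqrt Y)⁻¹ * normalizedTargets Y * ((corrSqrt Y)⁻¹ * normalizedTargets Y)ᵀ =
      (M : ℝ) • (1 : Matrix (Fin n) (Fin n) ℝ) := by
    rw [Matrix.transpose_mul, hT, Matrix.mul_assoc, ← Matrix.mul_assoc (normalizedTargets Y),
      normalizedTargets_mul_transpose hM, ← hP, Matrix.smul_mul, Matrix.mul_smul,
      Matrix.mul_nonsing_inv_cancel_right _ _ hdet, Matrix.nonsing_inv_mul _ hdet]
  rw [Matrix.smul_mul, Matrix.mul_smul, frobSq_smul, frobSq_eq_trace (_ * _),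
    Matrix.transpose_mul (stdMatrix Y), Matrix.mul_assoc (stdMatrix Y),
    ← Matrix.mul_assoc (_ * _) (_ᵀ), key, ← frobSq_stdMatrix hcov, frobSq_eq_trace (stdMatrix Y)]
  simp only [Matrix.smul_mul, Matrix.mul_smul, Matrix.one_mul, Matrix.trace_smul, smul_eq_mul]
  field_simp

end Targets

/-! ### Characterization of the global minima. -/

section Minimizers

variable {n M d : ℕ} {lamH lamW : ℝ} {T : Matrix (Fin n) (Fin M) ℝ}

theorem exists_semiorthogonal (h : n ≤ d) : ∃ R : Matrix (Fin n) (Fin d) ℝ, R * Rᵀ = 1 := by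
  refine ⟨Matrix.of fun i j => if Fin.castLE h i = j then 1 else 0, ?_⟩
  ext i k
  simp [Matrix.mul_apply, Matrix.one_apply, eq_comm]

/-- Factorizations `W Wᵀ = r B` of a positive definite matrix. -/
theorem mul_transpose_eq_smul_iff {B : Matrix (Fin n) (Fin n) ℝ} (hB : B.PosDef) {s : ℝ}
    (hs : 0 < s) (W : Matrix (Fin n) (Fin d) ℝ) :
    W * Wᵀ = (s * s) • B ↔ ∃ R : Matrix (Fin n) (Fin d) ℝ, R * Rᵀ = 1 ∧
      W = s • (CFC.sqrt B * R) := by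
  have hBB := sqrt_mul_sqrt hB.posSemidef
  constructor
  · intro h
    have hu : IsUnit (CFC.sqrt B) :=
      (CFC.isUnit_sqrt_iff B hB.posSemidef.nonneg).2 hB.isUnit
    have hdet : IsUnit (CFC.sqrt B).det := (Matrix.isUnit_iff_isUnit_det _).1 hu
    -- The witness is the polar factor of `W`, up to the scale `s`.
    refine ⟨s⁻¹ • ((CFC.sqrt B)⁻¹ * W), ?_, ?_⟩
    · have hT : (CFC.sqrt B)⁻¹ᵀ = (CFC.sqrt B)⁻¹ := by
        rw [Matrix.transpose_nonsing_inv, sqrt_transpose]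
      have e : (CFC.sqrt B)⁻¹ * W * (Wᵀ * (CFC.sqrt B)⁻¹) =
          (CFC.sqrt B)⁻¹ * (W * Wᵀ) * (CFC.sqrt B)⁻¹ := by
        simp only [Matrix.mul_assoc]
      have e2 : (CFC.sqrt B)⁻¹ * B * (CFC.sqrt B)⁻¹ = 1 := by
        nth_rw 2 [← hBB]
        rw [Matrix.nonsing_inv_mul_cancel_left _ _ hdet, Matrix.mul_nonsing_inv _ hdet]
      rw [Matrix.transpose_smul, Matrix.transpose_mul, hT, Matrix.smul_mul, Matrix.mul_smul, e, h,
        Matrix.mul_smul, Matrix.smul_mul, e2, smul_smul, smul_smul]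
      have : s⁻¹ * s⁻¹ * (s * s) = 1 := by field_simp
      rw [this, one_smul]
    · rw [Matrix.mul_smul, Matrix.mul_nonsing_inv_cancel_left _ _ hdet, smul_smul,
        mul_inv_cancel₀ hs.ne', one_smul]
  · rintro ⟨R, hR, rfl⟩
    rw [Matrix.transpose_smul, Matrix.transpose_mul, sqrt_transpose, Matrix.smul_mul,
      Matrix.mul_smul, smul_smul, Matrix.mul_assoc, ← Matrix.mul_assoc R, hR, Matrix.one_mul, hBB]

/-- The shift `λ_H I` inside `K` becomes `√c I`, because `λ_H = √(λ_H/λ_W) √c`. -/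
theorem regGram_balance_iff (hH : 0 < lamH) (hW : 0 < lamW) (Q : Matrix (Fin n) (Fin n) ℝ)
    (W : Matrix (Fin n) (Fin d) ℝ) :
    √lamH • Q - √lamW • regGram lamH W = 0 ↔
      W * Wᵀ = √(lamH / lamW) • (Q - √(lamH * lamW) • (1 : Matrix (Fin n) (Fin n) ℝ)) := by
  have ha := Real.sqrt_pos.2 hH
  have hb := Real.sqrt_pos.2 hW
  have s1 := Real.mul_self_sqrt hH.le
  rw [Real.sqrt_div hH.le, Real.sqrt_mul hH.le, ← Matrix.ext_iff, ← Matrix.ext_iff]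
  refine forall_congr' fun i => forall_congr' fun j => ?_
  simp only [regGram, Matrix.sub_apply, Matrix.smul_apply, Matrix.add_apply, Matrix.zero_apply,
    smul_eq_mul]
  rw [div_mul_eq_mul_div, eq_div_iff hb.ne', sub_eq_zero]
  constructor <;> intro h
  · linear_combination -h + (√lamW * (1 : Matrix (Fin n) (Fin n) ℝ) i j) * s1
  · linear_combination -h + (√lamW * (1 : Matrix (Fin n) (Fin n) ℝ) i j) * s1

theorem regGram_eq_of_balance (hH : 0 < lamH) (hW : 0 < lamW) {Q : Matrix (Fin n) (Fin n) ℝ}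
    {W : Matrix (Fin n) (Fin d) ℝ} (h : √lamH • Q - √lamW • regGram lamH W = 0) :
    (regGram lamH W)⁻¹ = √(lamW / lamH) • Q⁻¹ := by
  have ha := Real.sqrt_pos.2 hH
  have hb := Real.sqrt_pos.2 hW
  have hK : Q = √(lamW / lamH) • regGram lamH W := by
    rw [Real.sqrt_div hW.le, div_eq_inv_mul, mul_smul, ← sub_eq_zero.1 h, smul_smul,
      inv_mul_cancel₀ ha.ne', one_smul]
  have hr : √(lamW / lamH) ≠ 0 := (Real.sqrt_pos.2 (div_pos hW hH)).ne'
  have hdet := (Matrix.isUnit_iff_isUnit_det _).1 (regGram_posDef hH W).isUnit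
  refine Matrix.inv_eq_right_inv ?_
  rw [Matrix.mul_smul, ← Matrix.smul_mul, ← hK]
  refine Matrix.mul_nonsing_inv _ ((Matrix.isUnit_iff_isUnit_det _).1 ?_)
  rw [hK]
  exact ((regGram_posDef hH W).smul (Real.sqrt_pos.2 (div_pos hW hH))).isUnit

/-- Global minima under weak regularization. -/
theorem isGlobalMin_iff_of_posDef (hM : 0 < M) (hH : 0 < lamH) (hW : 0 < lamW) (hd : n ≤ d)
    {Q : Matrix (Fin n) (Fin n) ℝ} (hQT : Qᵀ = Q) (hTQ : T * Tᵀ = (M : ℝ) • (Q * Q))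
    (hB : (Q - √(lamH * lamW) • (1 : Matrix (Fin n) (Fin n) ℝ)).PosDef)
    (H : Matrix (Fin d) (Fin M) ℝ) (W : Matrix (Fin n) (Fin d) ℝ) :
    IsGlobalMin lamH lamW T H W ↔
      W * Wᵀ = √(lamH / lamW) • (Q - √(lamH * lamW) • (1 : Matrix (Fin n) (Fin n) ℝ)) ∧
      H = √(lamW / lamH) • (Wᵀ * Q⁻¹ * T) := by
  have hMR : (0 : ℝ) < M := by positivity
  have hdec := loss_decomposition hM hH hW hTQ (d := d)
  have hDT : ∀ W : Matrix (Fin n) (Fin d) ℝ,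
      (√lamH • Q - √lamW • regGram lamH W)ᵀ = √lamH • Q - √lamW • regGram lamH W := by
    intro W
    simp [regGram, hQT]
  have hpos : ∀ W : Matrix (Fin n) (Fin d) ℝ, ((√lamH • Q - √lamW • regGram lamH W) *
      (regGram lamH W)⁻¹ * (√lamH • Q - √lamW • regGram lamH W)).PosSemidef := by
    intro W
    have := (regGram_posDef hH W).inv.posSemidef.mul_mul_conjTranspose_same
      (√lamH • Q - √lamW • regGram lamH W)
    rwa [Matrix.conjTranspose_eq_transpose_of_trivial, hDT] at this
  -- With `D` the symmetric difference, a positive semidefinite `D K⁻¹ D` of trace zero vanishes. If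
  -- `D v ≠ 0`, then `(D v)ᵀ K⁻¹ (D v) > 0` contradicts this.
  have hzero : ∀ W : Matrix (Fin n) (Fin d) ℝ, ((√lamH • Q - √lamW • regGram lamH W) *
      (regGram lamH W)⁻¹ * (√lamH • Q - √lamW • regGram lamH W)).trace = 0 →
      √lamH • Q - √lamW • regGram lamH W = 0 := by
    intro W h
    by_contra hne
    obtain ⟨v, hv⟩ : ∃ v, (√lamH • Q - √lamW • regGram lamH W) *ᵥ v ≠ 0 := by
      by_contra! hall
      exact hne (Matrix.ext_of_mulVec_single fun i => by rw [hall, Matrix.zero_mulVec])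
    have h1 := (regGram_posDef hH W).inv.dotProduct_mulVec_pos hv
    have h2 := (hpos W).trace_eq_zero_iff.1 h
    have h3 : star ((√lamH • Q - √lamW • regGram lamH W) *ᵥ v) ⬝ᵥ
        ((regGram lamH W)⁻¹ *ᵥ ((√lamH • Q - √lamW • regGram lamH W) *ᵥ v)) = 0 := by
      have hsymm : ∀ x, ((√lamH • Q - √lamW • regGram lamH W) *ᵥ v) ⬝ᵥ x =
          v ⬝ᵥ ((√lamH • Q - √lamW • regGram lamH W) *ᵥ x) := fun x => by
        rw [Matrix.dotProduct_mulVec, ← Matrix.mulVec_transpose, hDT]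
      rw [star_trivial, hsymm, Matrix.mulVec_mulVec, Matrix.mulVec_mulVec, h2, Matrix.zero_mulVec,
        dotProduct_zero]
    exact h1.ne' h3
  set m : ℝ := M * (2 * √(lamH * lamW) * Q.trace - n * (lamH * lamW))
  have hlow : ∀ (H' : Matrix (Fin d) (Fin M) ℝ) (W' : Matrix (Fin n) (Fin d) ℝ),
      m ≤ 2 * M * loss lamH lamW T H' W' := by
    intro H' W'
    rw [hdec]
    have p1 := frobSq_nonneg (W' * (H' - W'ᵀ * ((regGram lamH W')⁻¹ * T)))
    have p2 := mul_nonneg hH.le (frobSq_nonneg (H' - W'ᵀ * ((regGram lamH W')⁻¹ * T)))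
    have p3 := mul_nonneg hMR.le (hpos W').trace_nonneg
    linarith
  have heq : ∀ (H' : Matrix (Fin d) (Fin M) ℝ) (W' : Matrix (Fin n) (Fin d) ℝ),
      2 * M * loss lamH lamW T H' W' = m ↔
      W' * W'ᵀ = √(lamH / lamW) • (Q - √(lamH * lamW) • (1 : Matrix (Fin n) (Fin n) ℝ)) ∧
      H' = √(lamW / lamH) • (W'ᵀ * Q⁻¹ * T) := by
    intro H' W'
    rw [← regGram_balance_iff hH hW]
    constructor
    · intro h
      rw [hdec] at h
      have p1 := frobSq_nonneg (W' * (H' - W'ᵀ * ((regGram lamH W')⁻¹ * T)))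
      have p2 := mul_nonneg hH.le (frobSq_nonneg (H' - W'ᵀ * ((regGram lamH W')⁻¹ * T)))
      have p3 := mul_nonneg hMR.le (hpos W').trace_nonneg
      have z2 : lamH * frobSq (H' - W'ᵀ * ((regGram lamH W')⁻¹ * T)) = 0 := by linarith
      have z3 := hzero W' ((mul_eq_zero.1 (by linarith :
        (M : ℝ) * ((√lamH • Q - √lamW • regGram lamH W') * (regGram lamH W')⁻¹ *
          (√lamH • Q - √lamW • regGram lamH W')).trace = 0)).resolve_left hMR.ne')
      refine ⟨z3, ?_⟩
      have z4 := frobSq_eq_zero_iff.1 ((mul_eq_zero.1 z2).resolve_left hH.ne')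
      rw [sub_eq_zero.1 z4, regGram_eq_of_balance hH hW z3, Matrix.smul_mul, Matrix.mul_smul,
        Matrix.mul_assoc]
    · rintro ⟨h1, h2⟩
      have z4 : H' - W'ᵀ * ((regGram lamH W')⁻¹ * T) = 0 := by
        rw [h2, regGram_eq_of_balance hH hW h1, Matrix.smul_mul, Matrix.mul_smul,
          Matrix.mul_assoc, sub_self]
      rw [hdec, z4, h1]
      simp [frobSq_eq_zero_iff.2, m]
  rw [← heq]
  constructor
  · intro hmin
    -- The lower bound `m` must be attained before a minimizer can be said to reach it. This is
    -- where `n ≤ d` is needed.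
    obtain ⟨R, hR⟩ := exists_semiorthogonal hd
    set s := √√(lamH / lamW)
    have hss : s * s = √(lamH / lamW) := Real.mul_self_sqrt (Real.sqrt_nonneg _)
    have hs : 0 < s := Real.sqrt_pos.2 (Real.sqrt_pos.2 (div_pos hH hW))
    have hW0 := (mul_transpose_eq_smul_iff hB hs _).2 ⟨R, hR, rfl⟩
    rw [hss] at hW0
    have hval := (heq _ _).2 ⟨hW0, rfl⟩
    refine le_antisymm ?_ (hlow H W)
    rw [← hval]
    exact mul_le_mul_of_nonneg_left (hmin _ _) (by positivity)
  · intro h H' W'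
    have := hlow H' W'
    rw [← h] at this
    exact le_of_mul_le_mul_left this (by positivity)

/-- Global minima under strong regularization. -/
theorem isGlobalMin_iff_zero (hM : 0 < M) (hH : 0 < lamH)
    {P : Matrix (Fin n) (Fin n) ℝ} (hTP : T * Tᵀ = (M : ℝ) • P) {mu : ℝ}
    (hP : (mu • (1 : Matrix (Fin n) (Fin n) ℝ) - P).PosSemidef) (hmu : mu < lamH * lamW)
    (H : Matrix (Fin d) (Fin M) ℝ) (W : Matrix (Fin n) (Fin d) ℝ) :
    IsGlobalMin lamH lamW T H W ↔ H = 0 ∧ W = 0 := by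
  have hMR : (0 : ℝ) < M := by positivity
  have hlow : ∀ (H' : Matrix (Fin d) (Fin M) ℝ) (W' : Matrix (Fin n) (Fin d) ℝ),
      frobSq T + lamH * frobSq (H' - lamH⁻¹ • (W'ᵀ * T)) +
        M * (lamW - lamH⁻¹ * mu) * frobSq W' ≤ 2 * M * loss lamH lamW T H' W' := by
    intro H' W'
    have h1 : 2 * M * loss lamH lamW T H' W' =
        frobSq (W' * H' - T) + lamH * frobSq H' + M * lamW * frobSq W' := by
      rw [loss]
      field_simp
    have h2 : (H' * (W'ᵀ * T)ᵀ).trace = (W' * H' * Tᵀ).trace := by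
      rw [Matrix.transpose_mul, Matrix.transpose_transpose, ← Matrix.mul_assoc,
        Matrix.trace_mul_comm, Matrix.mul_assoc]
    -- Take the trace of `W'ᵀ (μ I - P) W'`, which is positive semidefinite.
    have h3 : frobSq (W'ᵀ * T) ≤ M * mu * frobSq W' := by
      have h := (hP.conjTranspose_mul_mul_same W').trace_nonneg
      rw [Matrix.conjTranspose_eq_transpose_of_trivial, Matrix.mul_sub, Matrix.sub_mul,
        Matrix.mul_smul, Matrix.smul_mul, Matrix.mul_one, Matrix.trace_sub, Matrix.trace_smul,
        Matrix.trace_mul_comm W'ᵀ W', ← frobSq_eq_trace, smul_eq_mul] at h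
      have e : frobSq (W'ᵀ * T) = M * (W'ᵀ * P * W').trace := by
        rw [frobSq_eq_trace, Matrix.transpose_mul, Matrix.transpose_transpose, Matrix.mul_assoc,
          ← Matrix.mul_assoc T, hTP, Matrix.smul_mul, Matrix.mul_smul, Matrix.trace_smul,
          smul_eq_mul, Matrix.mul_assoc]
      rw [e]
      nlinarith
    have h4 := frobSq_nonneg (W' * H')
    have h5 : lamH⁻¹ * frobSq (W'ᵀ * T) ≤ lamH⁻¹ * (M * mu * frobSq W') :=
      mul_le_mul_of_nonneg_left h3 (by positivity)
    rw [h1, frobSq_sub, frobSq_sub, frobSq_smul, Matrix.transpose_smul, Matrix.mul_smul,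
      Matrix.trace_smul, smul_eq_mul, h2]
    have e1 : lamH * (frobSq H' - 2 * (lamH⁻¹ * (W' * H' * Tᵀ).trace) +
        lamH⁻¹ ^ 2 * frobSq (W'ᵀ * T)) = lamH * frobSq H' - 2 * (W' * H' * Tᵀ).trace +
        lamH⁻¹ * frobSq (W'ᵀ * T) := by
      field_simp
    rw [e1]
    linarith
  have hgap : 0 < M * (lamW - lamH⁻¹ * mu) := by
    refine mul_pos hMR (sub_pos.2 ?_)
    rw [inv_mul_lt_iff₀ hH]
    exact hmu
  have h0 : 2 * M * loss lamH lamW T (0 : Matrix (Fin d) (Fin M) ℝ) 0 = frobSq T := by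
    rw [loss]
    simp only [Matrix.zero_mul, zero_sub, frobSq_neg, frobSq_eq_zero_iff.2]
    field_simp
    ring
  constructor
  · intro hmin
    have h1 := mul_le_mul_of_nonneg_left (hmin 0 0) (by positivity : (0 : ℝ) ≤ 2 * M)
    rw [h0] at h1
    have h2 := hlow H W
    have p1 := mul_nonneg hH.le (frobSq_nonneg (H - lamH⁻¹ • (Wᵀ * T)))
    have p2 := mul_nonneg hgap.le (frobSq_nonneg W)
    have hW0 : W = 0 := frobSq_eq_zero_iff.1
      ((mul_eq_zero.1 (by linarith : _ * frobSq W = 0)).resolve_left hgap.ne')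
    have hH0 := frobSq_eq_zero_iff.1 ((mul_eq_zero.1
      (by linarith : lamH * frobSq (H - lamH⁻¹ • (Wᵀ * T)) = 0)).resolve_left hH.ne')
    subst hW0
    refine ⟨?_, rfl⟩
    simpa using hH0
  · rintro ⟨rfl, rfl⟩ H' W'
    have h2 := hlow H' W'
    have p1 := mul_nonneg hH.le (frobSq_nonneg (H' - lamH⁻¹ • (W'ᵀ * T)))
    have p2 := mul_nonneg hgap.le (frobSq_nonneg W')
    refine le_of_mul_le_mul_left (?_ : 2 * (M : ℝ) * _ ≤ 2 * M * _) (by positivity)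
    rw [h0]
    linarith

end Minimizers

end UFM

open scoped Matrix MatrixOrder in
theorem theorem5p3 {n M d : ℕ} (hn : 1 ≤ n) (Y : Matrix (Fin n) (Fin M) ℝ)
    (hcov : (UFM.sampleCov Y).rank = n)
    (lamH lamW c : ℝ) (hlamH : 0 ≤ lamH) (hlamW : 0 ≤ lamW) (hc : c = lamH * lamW) :
    -- training with the bias term amounts to training without it, with optimal bias zero
    (0 < c →
      ∀ (H : Matrix (Fin d) (Fin M) ℝ) (W : Matrix (Fin n) (Fin d) ℝ) (b : Fin n → ℝ),
        UFM.IsGlobalMinWithBias lamH lamW (UFM.normalizedTargets Y) H W b ↔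
          UFM.IsGlobalMin lamH lamW (UFM.normalizedTargets Y) H W ∧ b = 0) ∧
    -- the case of weak regularization
    (n ≤ d → 0 < c → c < UFM.corrEigenvalueMin Y →
      (∀ (H : Matrix (Fin d) (Fin M) ℝ) (W : Matrix (Fin n) (Fin d) ℝ),
        UFM.IsGlobalMin lamH lamW (UFM.normalizedTargets Y) H W ↔
          ∃ R : Matrix (Fin n) (Fin d) ℝ, R * Rᵀ = 1 ∧
            W = (lamH / lamW) ^ (1 / 4 : ℝ) •
              (CFC.sqrt (UFM.corrSqrt Y - √c • (1 : Matrix (Fin n) (Fin n) ℝ)) * R) ∧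
            H = √(lamW / lamH) • (Wᵀ * (UFM.corrSqrt Y)⁻¹ * UFM.normalizedTargets Y)) ∧
      (∀ (H : Matrix (Fin d) (Fin M) ℝ) (W : Matrix (Fin n) (Fin d) ℝ),
        UFM.IsGlobalMin lamH lamW (UFM.normalizedTargets Y) H W →
          W * H = (1 - √c • (UFM.corrSqrt Y)⁻¹) * UFM.normalizedTargets Y ∧
          UFM.mseDenormalize Y H W = c * UFM.covEigenvalueSum Y)) ∧
    -- the case of strong regularization
    (UFM.corrEigenvalueMax Y < c →
      (∀ (H : Matrix (Fin d) (Fin M) ℝ) (W : Matrix (Fin n) (Fin d) ℝ),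
        UFM.IsGlobalMin lamH lamW (UFM.normalizedTargets Y) H W ↔ H = 0 ∧ W = 0) ∧
      (∀ (H : Matrix (Fin d) (Fin M) ℝ) (W : Matrix (Fin n) (Fin d) ℝ),
        UFM.IsGlobalMin lamH lamW (UFM.normalizedTargets Y) H W →
          UFM.mseDenormalize Y H W = UFM.covEigenvalueSum Y)) := by
  -- Without samples the covariance would be zero, contradicting rank `n ≥ 1`.
  have hM : 0 < M := by
    rcases Nat.eq_zero_or_pos M with rfl | h
    · have : UFM.sampleCov Y = 0 := by simp [UFM.sampleCov]
      rw [this, Matrix.rank_zero] at hcov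
      omega
    · exact h
  have hCov := UFM.sampleCov_posDef hcov
  have hCorr := UFM.sampleCorr_posDef hCov
  have hP : UFM.corrSqrt Y * UFM.corrSqrt Y = UFM.sampleCorr Y :=
    UFM.sqrt_mul_sqrt hCorr.posSemidef
  have hQT : (UFM.corrSqrt Y)ᵀ = UFM.corrSqrt Y := UFM.sqrt_transpose _
  have hTP := UFM.normalizedTargets_mul_transpose hM Y
  have hpos : 0 < c → 0 < lamH ∧ 0 < lamW := fun h => by
    rw [hc] at h
    exact ⟨pos_of_mul_pos_left h hlamW, pos_of_mul_pos_right h hlamH⟩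
  refine ⟨fun h0 H W b => ?_, fun hd h0 hlt => ?_, fun hlt => ?_⟩
  · exact UFM.isGlobalMinWithBias_iff hM (UFM.sum_normalizedTargets hM Y) (hpos h0).1 H W b
  · obtain ⟨hH, hW⟩ := hpos h0
    have hB : (UFM.corrSqrt Y - √c • (1 : Matrix (Fin n) (Fin n) ℝ)).PosDef :=
      UFM.posDef_sqrt_sub_smul_one (UFM.sampleCorr_isHermitian Y) h0.le
        fun i => hlt.trans_le (UFM.corrEigenvalueMin_le Y i)
    have hQu : IsUnit (UFM.corrSqrt Y) :=
      (CFC.isUnit_sqrt_iff _ (Matrix.nonneg_iff_posSemidef.2 hCorr.posSemidef)).2 hCorr.isUnit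
    have hQdet : IsUnit (UFM.corrSqrt Y).det := (Matrix.isUnit_iff_isUnit_det _).1 hQu
    have hiff := UFM.isGlobalMin_iff_of_posDef (d := d) hM hH hW hd hQT (hP ▸ hTP)
      (by rwa [← hc])
    have hquot := div_pos hH hW
    have hs : 0 < (lamH / lamW) ^ (1 / 4 : ℝ) := Real.rpow_pos_of_pos hquot _
    have hss : (lamH / lamW) ^ (1 / 4 : ℝ) * (lamH / lamW) ^ (1 / 4 : ℝ) = √(lamH / lamW) := by
      rw [← Real.rpow_add hquot, Real.sqrt_eq_rpow]
      norm_num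
    have hpred : ∀ (H : Matrix (Fin d) (Fin M) ℝ) (W : Matrix (Fin n) (Fin d) ℝ),
        UFM.IsGlobalMin lamH lamW (UFM.normalizedTargets Y) H W →
          W * H = (1 - √c • (UFM.corrSqrt Y)⁻¹) * UFM.normalizedTargets Y := by
      intro H W hmin
      obtain ⟨h1, h2⟩ := (hiff H W).1 hmin
      have hr : √(lamW / lamH) * √(lamH / lamW) = 1 := by
        rw [← Real.sqrt_mul (div_pos hW hH).le, div_mul_div_cancel₀ hH.ne', div_self hW.ne',
          Real.sqrt_one]
      rw [h2, Matrix.mul_smul, ← Matrix.mul_assoc, ← Matrix.mul_assoc, h1, ← hc, Matrix.smul_mul,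
        Matrix.smul_mul, smul_smul, hr, one_smul, Matrix.sub_mul, Matrix.smul_mul, Matrix.one_mul,
        Matrix.mul_nonsing_inv _ hQdet]
    refine ⟨fun H W => ?_, fun H W hmin => ⟨hpred H W hmin, ?_⟩⟩
    · rw [hiff, ← hc, ← hss, UFM.mul_transpose_eq_smul_iff hB hs]
      constructor
      · rintro ⟨⟨R, h1, h2⟩, h3⟩
        exact ⟨R, h1, h2, h3⟩
      · rintro ⟨R, h1, h2, h3⟩
        exact ⟨⟨R, h1, h2⟩, h3⟩
    · have e : (1 - √c • (UFM.corrSqrt Y)⁻¹) * UFM.normalizedTargets Y - UFM.normalizedTargets Y =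
          (-√c) • (UFM.corrSqrt Y)⁻¹ * UFM.normalizedTargets Y := by
        rw [Matrix.sub_mul, Matrix.one_mul, neg_smul, Matrix.neg_mul]
        abel
      rw [UFM.mseDenormalize_eq hCov, hpred H W hmin, e, UFM.frobSq_stdMatrix_mul hM Y hCov hQu,
        neg_sq, Real.sq_sqrt h0.le]
  -- Positivity of `c` is not assumed here: it follows because `P` is positive definite and `n ≥ 1`
  -- supplies an eigenvalue.
  · have hc0 : 0 < c :=
      (hCorr.eigenvalues_pos ⟨0, hn⟩).trans ((UFM.le_corrEigenvalueMax Y ⟨0, hn⟩).trans_lt hlt)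
    have hiff := UFM.isGlobalMin_iff_zero (d := d) hM (hpos hc0).1 hTP
      (UFM.posSemidef_smul_one_sub (UFM.sampleCorr_isHermitian Y) (UFM.le_corrEigenvalueMax Y))
      (hc ▸ hlt)
    refine ⟨hiff, fun H W hmin => ?_⟩
    obtain ⟨rfl, rfl⟩ := (hiff H W).1 hmin
    have hM' : (M : ℝ) ≠ 0 := by positivity
    rw [UFM.mseDenormalize_eq hCov, Matrix.zero_mul, zero_sub, Matrix.mul_neg, UFM.frobSq_neg,
      UFM.stdMatrix_mul_normalizedTargets hCov, UFM.frobSq_eq_trace, UFM.covEigenvalueSum_eq_trace,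
      UFM.sampleCov, Matrix.trace_smul, smul_eq_mul]
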